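/- Let $\mathbb{F}$ be a perfect field, $n\ge 0$, and let $G=\langle g_1,\dots,g_r\rangle\le \mathrm{GL}(n,\mathbb{F})$. For a matrix $x\in\mathrm{GL}(n,\mathbb{K})$ over a perfect field $\mathbb{K}$ let $x=x_sx_u=x_ux_s$ be its Jordan decomposition, with $x_s\in\mathrm{GL}(n,\mathbb{K})$ diagonalizable over some extension field of $\mathbb{K}$ and $x_u\in\mathrm{GL}(n,\mathbb{K})$ unipotent. For a group $H=\langle h_1,\dots,h_r\rangle\le\mathrm{GL}(n,\mathbb{K})$ given by generators put $H_s=\langle (h_1)_s,\dots,(h_r)_s\rangle$ and $H_u=\langle (h_1)_u,\dots,(h_r)_u\rangle$. Let $\Delta$ be a subring of $\mathbb{F}$ such that $G_s\le\mathrm{GL}(n,\Delta)$, and let $\varrho$ be a maximal ideal of $\Delta$ whose residue field $\Delta/\varrho$ is finite, of characteristic $p$ (if $\Delta$ is a finitely generated ring, then $\Delta/\varrho$ is finite for every maximal ideal $\varrho$). Let $\psi_\varrho:\mathrm{GL}(n,\Delta)\to\mathrm{GL}(n,\Delta/\varrho)$ be entrywise reduction modulo $\varrho$. Assume that the kernel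 of $\psi_\varrho$ is torsion-free if $\mathrm{char}\,\Delta=0$, and that all torsion elements of this kernel are unipotent if $\mathrm{char}\,\Delta>0$. If $G_s$ is nilpotent and $p>n$, then every $h\in G_s$ with $\psi_\varrho(h)\in(\psi_\varrho(G_s))_u$ is central in $G_s$, where $\psi_\varrho(G_s)$ is given by the generators $\psi_\varrho((g_1)_s),\dots,\psi_\varrho((g_r)_s)$. -/

import Mathlib

open Matrix Polynomial

namespace NilpotentMatrix

universe u

/-- A matrix over a field is *diagonalizable* if it is conjugate to a diagonal matrix over some
extension of the ground field. -/
def IsDiagonalizable {K : Type u} [Field K] {n : ℕ} (g : GL (Fin n) K) : Prop :=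
  ∃ (E : Type u) (_ : Field E) (_ : Algebra K E) (P : GL (Fin n) E) (d : Fin n → E),
    (g : Matrix (Fin n) (Fin n) K).map (algebraMap K E) * (P : Matrix (Fin n) (Fin n) E) =
      (P : Matrix (Fin n) (Fin n) E) * Matrix.diagonal d

/-- A matrix `g` is *unipotent* if `g - 1` is nilpotent. -/
def IsUnipotent {R : Type*} [CommRing R] {n : ℕ} (g : GL (Fin n) R) : Prop :=
  IsNilpotent ((g : Matrix (Fin n) (Fin n) R) - 1)

/-- `g = s u = u s` with `s` diagonalizable and `u` unipotent: the (multiplicative) Jordan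
decomposition of `g`. -/
def IsJordanDecomposition {K : Type u} [Field K] {n : ℕ} (g s u : GL (Fin n) K) : Prop :=
  IsDiagonalizable s ∧ IsUnipotent u ∧ g = s * u ∧ g = u * s

theorem exists_diagonal_of_isSemisimple {E : Type u} [Field E] [IsAlgClosed E] {n : ℕ}
    (f : Module.End E (Fin n → E)) (hf : f.IsSemisimple) :
    ∃ (P : GL (Fin n) E) (d : Fin n → E),
      LinearMap.toMatrix' f * (P : Matrix (Fin n) (Fin n) E) =
        (P : Matrix (Fin n) (Fin n) E) * Matrix.diagonal d := by
  classical
  have htop : ⨆ μ, f.eigenspace μ = ⊤ := hf.iSup_eigenspace_eq_top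
  have hint : DirectSum.IsInternal (fun μ : E => f.eigenspace μ) :=
    (DirectSum.isInternal_submodule_iff_iSupIndep_and_iSup_eq_top _).2
      ⟨f.eigenspaces_iSupIndep, htop⟩
  let b := hint.collectedBasis (fun μ => Module.finBasis E (f.eigenspace μ))
  have : Fintype (Σ μ : E, Fin (Module.finrank E (f.eigenspace μ))) :=
    FiniteDimensional.fintypeBasisIndex b
  have hcard : Fintype.card (Σ μ : E, Fin (Module.finrank E (f.eigenspace μ))) =
      Fintype.card (Fin n) := by
    rw [← Module.finrank_eq_card_basis b, ← Module.finrank_eq_card_basis (Pi.basisFun E (Fin n))]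
  let e := Fintype.equivOfCardEq hcard
  let c := b.reindex e
  let d : Fin n → E := fun j => (e.symm j).1
  have hc : ∀ j, f (c j) = d j • c j := by
    intro j
    have hm : c j ∈ f.eigenspace (d j) := by
      simp only [c, d, Module.Basis.reindex_apply]
      exact hint.collectedBasis_mem _ _
    exact Module.End.mem_eigenspace_iff.1 hm
  let Q : Matrix (Fin n) (Fin n) E := (Pi.basisFun E (Fin n)).toMatrix c
  have hQ : IsUnit Q := by
    let _ := (Pi.basisFun E (Fin n)).invertibleToMatrix c
    exact isUnit_of_invertible Q
  obtain ⟨P, hP⟩ := hQ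
  refine ⟨P, d, ?_⟩
  have hPe : (P : Matrix (Fin n) (Fin n) E) = Q := hP
  rw [hPe]
  ext i j
  have h1 : (LinearMap.toMatrix' f * Q) i j = (f (c j)) i := by
    have h2 : (LinearMap.toMatrix' f).mulVec (c j) = f (c j) := LinearMap.toMatrix'_mulVec f _
    rw [← h2]
    simp [Matrix.mul_apply, Matrix.mulVec, dotProduct, Q, Module.Basis.toMatrix_apply]
  rw [h1, hc]
  simp [Q, Module.Basis.toMatrix_apply, Matrix.mul_diagonal, mul_comm]

theorem isDiagonalizable_of_isSemisimple {K : Type u} [Field K] [PerfectField K] {n : ℕ}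
    (s : GL (Fin n) K)
    (hs : Module.End.IsSemisimple (Matrix.toLin' (s : Matrix (Fin n) (Fin n) K))) :
    IsDiagonalizable s := by
  let E := AlgebraicClosure K
  set p := minpoly K (Matrix.toLin' (s : Matrix (Fin n) (Fin n) K)) with hp
  have hsep : p.Separable := PerfectField.separable_iff_squarefree.2 hs.minpoly_squarefree
  have hsq : Squarefree (p.map (algebraMap K E)) := (hsep.map).squarefree
  set A : Matrix (Fin n) (Fin n) E := (s : Matrix (Fin n) (Fin n) K).map (algebraMap K E) with hA
  have h0 : aeval (s : Matrix (Fin n) (Fin n) K) p = 0 := by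
    have h1 : aeval (Matrix.toLin' (s : Matrix (Fin n) (Fin n) K)) p = 0 := minpoly.aeval _ _
    have h2 : aeval (Matrix.toLinAlgEquiv' (s : Matrix (Fin n) (Fin n) K)) p = 0 := h1
    rw [Polynomial.aeval_algEquiv] at h2
    simpa using h2
  have hA0 : aeval A p = 0 := by
    have h3 := Polynomial.aeval_algHom_apply ((Algebra.ofId K E).mapMatrix (m := Fin n))
      (s : Matrix (Fin n) (Fin n) K) p
    rw [h0, map_zero] at h3
    exact h3
  have hAE : aeval (Matrix.toLin' A) (p.map (algebraMap K E)) = 0 := by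
    have h4 : aeval (Matrix.toLinAlgEquiv' A) (p.map (algebraMap K E)) = 0 := by
      rw [Polynomial.aeval_algEquiv]
      simp [hA0]
    exact h4
  have hss : Module.End.IsSemisimple (Matrix.toLin' A) :=
    Module.End.isSemisimple_of_squarefree_aeval_eq_zero hsq hAE
  obtain ⟨P, d, h⟩ := exists_diagonal_of_isSemisimple _ hss
  refine ⟨E, inferInstance, inferInstance, P, d, ?_⟩
  simpa using h

/-- Over a perfect field the Jordan decomposition exists. -/
theorem exists_isJordanDecomposition {K : Type u} [Field K] [PerfectField K] {n : ℕ}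
    (g : GL (Fin n) K) : ∃ s u : GL (Fin n) K, IsJordanDecomposition g s u := by
  obtain ⟨N, hN, S, hS, hNil, hSs, hsum⟩ :=
    Module.End.exists_isNilpotent_isSemisimple
      (f := Matrix.toLin' (g : Matrix (Fin n) (Fin n) K))
  have hcomm : Commute N S :=
    Algebra.commute_of_mem_adjoin_of_forall_mem_commute hS (fun b hb => by
      rw [Set.mem_singleton_iff] at hb
      subst hb
      exact (Algebra.commute_of_mem_adjoin_self hN).symm)
  let φ := (Matrix.toLinAlgEquiv' (R := K) (n := Fin n)).symm
  have hg : (g : Matrix (Fin n) (Fin n) K) = φ N + φ S := by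
    rw [← map_add, ← hsum]
    exact (Matrix.toLinAlgEquiv'.symm_apply_apply _).symm
  have hc' : Commute (φ N) (φ S) := hcomm.map φ
  have hn' : IsNilpotent (φ N) := hNil.map φ
  have hgc : Commute (φ N) (g : Matrix (Fin n) (Fin n) K) := by
    rw [hg]; exact (Commute.refl _).add_right hc'
  have hSu : IsUnit (φ S) := by
    have h1 : φ S = (g : Matrix (Fin n) (Fin n) K) + -φ N := by rw [hg]; abel
    rw [h1]
    exact hn'.neg.isUnit_add_left_of_commute g.isUnit hgc.neg_left
  obtain ⟨s, hs⟩ := hSu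
  have hcs : Commute s g := by
    apply Units.ext
    simp only [Units.val_mul, hs]
    rw [hg]
    exact hc'.symm.add_right (Commute.refl _)
  refine ⟨s, s⁻¹ * g, ?_, ?_, by simp, ?_⟩
  · apply isDiagonalizable_of_isSemisimple
    have : Matrix.toLin' (s : Matrix (Fin n) (Fin n) K) = S := by
      have h2 : (s : Matrix (Fin n) (Fin n) K) = φ S := hs
      rw [h2]
      exact Matrix.toLinAlgEquiv'.apply_symm_apply S
    rw [this]; exact hSs
  · have h3 : ((s⁻¹ * g : GL (Fin n) K) : Matrix (Fin n) (Fin n) K) - 1 =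
        ((s⁻¹ : GL (Fin n) K) : Matrix (Fin n) (Fin n) K) * φ N := by
      have h4 : ((s⁻¹ : GL (Fin n) K) : Matrix (Fin n) (Fin n) K) * φ S = 1 := by
        rw [← hs]; exact s.inv_mul
      rw [Units.val_mul, hg, mul_add, h4, add_sub_cancel_right]
    have hcN : Commute ((s⁻¹ : GL (Fin n) K) : Matrix (Fin n) (Fin n) K) (φ N) := by
      have h5 : Commute (s : Matrix (Fin n) (Fin n) K) (φ N) := by
        have h6 : (s : Matrix (Fin n) (Fin n) K) = φ S := hs
        rw [h6]; exact hc'.symm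
      exact h5.units_inv_left
    unfold IsUnipotent
    rw [h3]
    exact hcN.isNilpotent_mul_left hn'
  · rw [mul_assoc, ← hcs.eq, inv_mul_cancel_left]

/-- The diagonalizable part `g_s` of `g`. -/
noncomputable def diagPart {K : Type u} [Field K] [PerfectField K] {n : ℕ}
    (g : GL (Fin n) K) : GL (Fin n) K :=
  (exists_isJordanDecomposition g).choose

/-- The unipotent part `g_u` of `g`. -/
noncomputable def unipotentPart {K : Type u} [Field K] [PerfectField K] {n : ℕ}
    (g : GL (Fin n) K) : GL (Fin n) K :=
  (exists_isJordanDecomposition g).choose_spec.choose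

theorem isJordanDecomposition_parts {K : Type u} [Field K] [PerfectField K] {n : ℕ}
    (g : GL (Fin n) K) : IsJordanDecomposition g (diagPart g) (unipotentPart g) :=
  (exists_isJordanDecomposition g).choose_spec.choose_spec

/-- `G_s = ⟨(g_1)_s, …, (g_r)_s⟩`, for the group `G` generated by `g_1, …, g_r`. -/
noncomputable def diagGroup {K : Type u} [Field K] [PerfectField K] {n r : ℕ}
    (g : Fin r → GL (Fin n) K) : Subgroup (GL (Fin n) K) :=
  Subgroup.closure (Set.range fun i => diagPart (g i))

/-- `G_u = ⟨(g_1)_u, …, (g_r)_u⟩`, for the group `G` generated by `g_1, …, g_r`. -/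
noncomputable def unipotentGroup {K : Type u} [Field K] [PerfectField K] {n r : ℕ}
    (g : Fin r → GL (Fin n) K) : Subgroup (GL (Fin n) K) :=
  Subgroup.closure (Set.range fun i => unipotentPart (g i))

/-- The congruence homomorphism `ψ_ϱ : GL(n, Δ) → GL(n, Δ/ϱ)`. -/
def congruenceHom (n : ℕ) {Δ : Type*} [CommRing Δ] (ϱ : Ideal Δ) :
    GL (Fin n) Δ →* GL (Fin n) (Δ ⧸ ϱ) :=
  Matrix.GeneralLinearGroup.map (Ideal.Quotient.mk ϱ)

/-- The principal congruence subgroup of `GL(n, Δ)` at `ϱ` is torsion-free if `char Δ = 0`, and all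
its torsion elements are unipotent if `char Δ > 0`. -/
def IsAdmissibleIdeal (n : ℕ) {Δ : Type*} [CommRing Δ] (ϱ : Ideal Δ) : Prop :=
  ∀ a ∈ (congruenceHom n ϱ).ker, IsOfFinOrder a →
    (ringChar Δ = 0 → a = 1) ∧ (0 < ringChar Δ → IsUnipotent a)

/-- For the group `H = ⟨σ_1, …, σ_r⟩ ≤ GL(n, Δ)` and a maximal ideal `ϱ` with finite residue field,
the group `(ψ_ϱ(H))_u`, generated by the unipotent parts of the `ψ_ϱ(σ_i)`. -/
noncomputable def congruenceUnipotentGroup {Δ : Type u} [CommRing Δ] (ϱ : Ideal Δ) [ϱ.IsMaximal]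
    [Finite (Δ ⧸ ϱ)] {n r : ℕ} (σ : Fin r → GL (Fin n) Δ) : Subgroup (GL (Fin n) (Δ ⧸ ϱ)) :=
  letI : Field (Δ ⧸ ϱ) := Ideal.Quotient.field ϱ
  unipotentGroup (K := Δ ⧸ ϱ) fun i => congruenceHom n ϱ (σ i)

end NilpotentMatrix

/-! Write `m = n!`, which is prime to `p` because `p > n`. The noncommutativity of `G_s` involves
only primes dividing `m`, while `ψ_ϱ(h)` is a `p`-element. Let `z` lie in the second centre and `x`
be a diagonalizable generator. Then `c = ⁅z, x⁆` is central and semisimple, and comparing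
determinants in `c x z = z x` on each `μ`-eigenspace `W` of `c` gives `μ ^ dim W = 1`. Hence `c ^ m
= 1` and `z ^ m` is central (`pow_factorial_mem_center`). Climbing the upper central series, a power
of `m` is an exponent of `G_s` modulo its centre; descending the lower one, a power of `m` kills
every commutator. Over the finite residue field unipotent parts are powers of the generators, so in
the finite nilpotent group `ψ_ϱ(G_s)` they generate a `p`-group. Thus `ψ_ϱ(h)` has `p`-power order,
while its power by a power of `m` is central; so `ψ_ϱ(h)` itself is central. Each commutator of `h`
with a generator is therefore a torsion element of the congruence kernel: trivial in characteristic
0, and otherwise unipotent, hence of order both a power of `p` and prime to `p`. -/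

open scoped commutatorElement

/-! ### Exponents along the central series of a nilpotent group -/

namespace Subgroup

theorem commutatorElement_pow_left_of_mem_center {G : Type*} [Group G] {a b : G}
    (h : ⁅a, b⁆ ∈ center G) (m : ℕ) : ⁅a ^ m, b⁆ = ⁅a, b⁆ ^ m := by
  induction m with
  | zero => simp
  | succ m ih =>
    rw [pow_succ, commutatorElement_mul_left_eq_conj_mul, ih, pow_succ']
    congr 1
    rw [mul_inv_eq_iff_eq_mul]
    exact (mem_center_iff.1 h _)

/-- If `D`-th powers of elements of the second centre are central, then `D`-th powers of elements
of each higher term of the upper central series lie in the preceding term. -/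
theorem pow_mem_upperCentralSeries {G : Type*} [Group G] {D : ℕ}
    (hD : ∀ z ∈ upperCentralSeries G 2, z ^ D ∈ center G) (i : ℕ) :
    ∀ y ∈ upperCentralSeries G (i + 2), y ^ D ∈ upperCentralSeries G (i + 1) := by
  induction i with
  | zero => intro y hy; rw [zero_add, upperCentralSeries_one]; exact hD y hy
  | succ i ih =>
    intro y hy
    rw [mem_upperCentralSeries_succ_iff]
    intro g
    have h1 : ⁅y, g⁆ ∈ upperCentralSeries G (i + 2) := mem_upperCentralSeries_succ_iff.1 hy g
    -- Modulo this term `⁅y, g⁆` is central, so `⁅y ^ D, g⁆` becomes `⁅y, g⁆ ^ D`, which the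
    -- induction hypothesis kills.
    let π := QuotientGroup.mk' (upperCentralSeries G (i + 1))
    have h2 : ⁅π y, π g⁆ ∈ center (G ⧸ upperCentralSeries G (i + 1)) := by
      rw [mem_center_iff]
      intro q
      obtain ⟨a, rfl⟩ := QuotientGroup.mk'_surjective _ q
      rw [← map_commutatorElement]
      refine (commutatorElement_eq_one_iff_mul_comm.1 ?_).symm
      rw [← map_commutatorElement]
      exact (QuotientGroup.eq_one_iff _).2 (mem_upperCentralSeries_succ_iff.1 h1 a)
    rw [← QuotientGroup.eq_one_iff]
    change π ⁅y ^ D, g⁆ = 1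
    rw [map_commutatorElement, map_pow, commutatorElement_pow_left_of_mem_center h2,
      ← map_commutatorElement, ← map_pow]
    exact (QuotientGroup.eq_one_iff _).2 (ih _ h1)

theorem exists_pow_mem_center {G : Type*} [Group G] [Group.IsNilpotent G] {D : ℕ}
    (hD : ∀ z ∈ upperCentralSeries G 2, z ^ D ∈ center G) :
    ∃ k, ∀ y : G, y ^ D ^ k ∈ center G := by
  -- Each `D`-th power descends one term; the shift by one makes the induction start at the centre.
  have key : ∀ i, ∀ y ∈ upperCentralSeries G (i + 1), y ^ D ^ i ∈ center G := by
    intro i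
    induction i with
    | zero => intro y hy; simpa using hy
    | succ i ih =>
      intro y hy
      rw [pow_succ', pow_mul]
      exact ih _ (pow_mem_upperCentralSeries hD i y hy)
  obtain ⟨c, hc⟩ := Group.IsNilpotent.nilpotent G
  refine ⟨c, fun y => key c y ?_⟩
  exact upperCentralSeries_mono G c.le_succ (hc ▸ mem_top y)

/-- In a nilpotent group of exponent `M` modulo the centre, each element of a positive term of the
lower central series is, modulo the next term, of exponent `M`. -/
theorem pow_mem_lowerCentralSeries_succ {G : Type*} [Group G] {M : ℕ}
    (hM : ∀ y : G, y ^ M ∈ center G) (i : ℕ) {k : G}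
    (hk : k ∈ (⊤ : Subgroup G).lowerCentralSeries (i + 1)) :
    k ^ M ∈ (⊤ : Subgroup G).lowerCentralSeries (i + 2) := by
  let L := (⊤ : Subgroup G).lowerCentralSeries (i + 2)
  let π := QuotientGroup.mk' L
  have hcen : ∀ a ∈ (⊤ : Subgroup G).lowerCentralSeries (i + 1), π a ∈ center (G ⧸ L) := by
    intro a ha
    rw [mem_center_iff]
    intro q
    obtain ⟨b, rfl⟩ := QuotientGroup.mk'_surjective _ q
    refine (commutatorElement_eq_one_iff_mul_comm.1 ?_).symm
    rw [← map_commutatorElement]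
    exact (QuotientGroup.eq_one_iff _).2 (commutator_mem_commutator ha (mem_top b))
  suffices h : π k ^ M = 1 by
    rw [← map_pow] at h
    exact (QuotientGroup.eq_one_iff _).1 h
  rw [mem_lowerCentralSeries_succ_iff] at hk
  -- On generators `⁅u, v⁆ ^ M` agrees with `⁅u ^ M, v⁆ = 1` modulo `L`. Membership is carried along
  -- because centrality of the images is what makes `M`-th powers multiplicative.
  have aux : k ∈ (⊤ : Subgroup G).lowerCentralSeries (i + 1) ∧ π k ^ M = 1 := by
    induction hk using closure_induction with
    | mem x hx =>
      have hx' : x ∈ (⊤ : Subgroup G).lowerCentralSeries (i + 1) := subset_closure hx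
      refine ⟨hx', ?_⟩
      obtain ⟨u, -, v, -, rfl⟩ := hx
      have h1 := hcen _ hx'
      rw [map_commutatorElement] at h1 ⊢
      rw [← commutatorElement_pow_left_of_mem_center h1, ← map_pow, ← map_commutatorElement,
        commutatorElement_eq_one_iff_mul_comm.2 (mem_center_iff.1 (hM u) v).symm, map_one]
    | one => exact ⟨one_mem _, by simp⟩
    | mul x y hx hy ihx ihy =>
      obtain ⟨hx1, hx2⟩ := ihx
      obtain ⟨hy1, hy2⟩ := ihy
      refine ⟨mul_mem hx1 hy1, ?_⟩
      have hc : Commute (π x) (π y) := (mem_center_iff.1 (hcen y hy1) (π x))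
      rw [map_mul, hc.mul_pow, hx2, hy2, one_mul]
    | inv x hx ihx =>
      obtain ⟨hx1, hx2⟩ := ihx
      exact ⟨inv_mem hx1, by rw [map_inv, inv_pow, hx2, inv_one]⟩
  exact aux.2

theorem exists_commutatorElement_pow_eq_one {G : Type*} [Group G] [Group.IsNilpotent G] {M : ℕ}
    (hM : ∀ y : G, y ^ M ∈ center G) : ∃ j, ∀ a b : G, ⁅a, b⁆ ^ M ^ j = 1 := by
  obtain ⟨c, hc⟩ := nilpotent_iff_lowerCentralSeries.1 ‹Group.IsNilpotent G›
  refine ⟨c, fun a b => ?_⟩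
  have key : ∀ i, ⁅a, b⁆ ^ M ^ i ∈ (⊤ : Subgroup G).lowerCentralSeries (i + 1) := by
    intro i
    induction i with
    | zero => simpa using commutator_mem_commutator (mem_top a) (mem_top b)
    | succ i ih =>
      rw [pow_succ, pow_mul]
      exact pow_mem_lowerCentralSeries_succ hM i ih
  have h := lowerCentralSeries_antitone ⊤ c.le_succ (key c)
  rwa [hc, mem_bot] at h

/-- In a finite nilpotent group the elements of `p`-power order are closed under multiplication. -/
theorem exists_pow_prime_pow_eq_one_of_mem_closure {G : Type*} [Group G] [Finite G]
    [Group.IsNilpotent G] {p : ℕ} [Fact p.Prime] {S : Set G}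
    (hS : ∀ s ∈ S, ∃ b, s ^ p ^ b = 1) {x : G} (hx : x ∈ Subgroup.closure S) :
    ∃ b, x ^ p ^ b = 1 := by
  -- Nilpotency makes the Sylow `p`-subgroup normal, hence unique, so it contains every element of
  -- `p`-power order.
  have hn : ∀ P : Sylow p G, (P : Subgroup G).Normal := by
    have h := (Group.isNilpotent_of_finite_tfae (G := G)).out 0 3
    exact h.1 ‹_› p ‹_›
  obtain ⟨P⟩ : Nonempty (Sylow p G) := inferInstance
  have hP := hn P
  have hle : Subgroup.closure S ≤ P := by
    rw [Subgroup.closure_le]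
    intro s hs
    obtain ⟨b, hb⟩ := hS s hs
    have hz : IsPGroup p (Subgroup.zpowers s) := by
      rintro ⟨_, i, rfl⟩
      refine ⟨b, Subtype.ext ?_⟩
      simp only [Subgroup.coe_pow, Subgroup.coe_one]
      rw [← zpow_natCast, ← _root_.zpow_mul, mul_comm, _root_.zpow_mul, zpow_natCast, hb, _root_.one_zpow]
    obtain ⟨Q, hQ⟩ := hz.exists_le_sylow
    have := Sylow.unique_of_normal P hP
    exact Subsingleton.elim Q P ▸ hQ (Subgroup.mem_zpowers s)
  obtain ⟨b, hb⟩ := P.isPGroup' ⟨x, hle hx⟩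
  exact ⟨b, by simpa using congrArg Subtype.val hb⟩

end Subgroup

/-! ### Coprime exponents -/

theorem eq_one_of_pow_eq_one_of_coprime {G : Type*} [Monoid G] {x : G} {a b : ℕ}
    (ha : x ^ a = 1) (hb : x ^ b = 1) (hab : a.Coprime b) : x = 1 :=
  orderOf_eq_one_iff.1 (Nat.eq_one_of_dvd_coprimes hab (orderOf_dvd_of_pow_eq_one ha)
    (orderOf_dvd_of_pow_eq_one hb))

theorem mem_zpowers_pow_of_coprime {G : Type*} [Group G] {x : G} {a b : ℕ} (hb : x ^ b = 1)
    (hab : a.Coprime b) : x ∈ Subgroup.zpowers (x ^ a) := by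
  refine ⟨a.gcdA b, ?_⟩
  have h := Nat.gcd_eq_gcd_ab a b
  rw [hab] at h
  calc (x ^ a) ^ a.gcdA b = x ^ ((a : ℤ) * a.gcdA b + b * a.gcdB b) := by
        rw [_root_.zpow_add, _root_.zpow_mul, _root_.zpow_mul, zpow_natCast, zpow_natCast, hb,
          _root_.one_zpow, mul_one]
    _ = x := by rw [← h]; simp

theorem Commute.of_pow_left_of_coprime {G : Type*} [Group G] {x y : G} {a b : ℕ}
    (ha : Commute (x ^ a) y) (hb : x ^ b = 1) (hab : a.Coprime b) : Commute x y := by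
  have h : Subgroup.zpowers (x ^ a) ≤ Subgroup.centralizer {y} :=
    Subgroup.zpowers_le.2 (Subgroup.mem_centralizer_singleton_iff.2 ha.eq)
  exact Subgroup.mem_centralizer_singleton_iff.1 (h (mem_zpowers_pow_of_coprime hb hab))

/-! ### Commutators of diagonalizable matrices -/

open Module in
/-- If the commutator `c` of two invertible endomorphisms `z`, `x` commutes with both and its
eigenspaces span, then `c ^ n! = 1` in dimension at most `n`. -/
theorem Module.End.pow_factorial_eq_one_of_mul_mul_eq {E V : Type*} [Field E] [AddCommGroup V]
    [Module E V] [FiniteDimensional E V] {c x z : End E V} (h : c * (x * z) = z * x)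
    (hcx : Commute c x) (hcz : Commute c z) (hx : Function.Injective x)
    (hz : Function.Injective z) (hc : ⨆ μ, c.eigenspace μ = ⊤) {n : ℕ} (hn : finrank E V ≤ n) :
    c ^ n.factorial = 1 := by
  have key : ∀ μ, c.eigenspace μ ≤ LinearMap.ker (c ^ n.factorial - 1) := by
    intro μ
    let W := c.eigenspace μ
    have hWx : ∀ v ∈ W, x v ∈ W := mapsTo_genEigenspace_of_comm hcx μ 1
    have hWz : ∀ v ∈ W, z v ∈ W := mapsTo_genEigenspace_of_comm hcz μ 1
    let x' := x.restrict hWx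
    let z' := z.restrict hWz
    -- On `W` the relation reads `μ x z = z x`; the determinants of `x` and `z` are nonzero there
    -- and cancel.
    have hdet : μ ^ finrank E W * (LinearMap.det x' * LinearMap.det z') =
        LinearMap.det z' * LinearMap.det x' := by
      rw [← map_mul, ← map_mul, ← LinearMap.det_smul]
      congr 1
      ext v
      have hv : x (z v) ∈ W := hWx _ (hWz _ v.2)
      have h1 : c (x (z v)) = z (x v) := LinearMap.congr_fun h v
      rw [mem_eigenspace_iff.1 hv] at h1
      exact h1
    have hne : ∀ f : End E W, Function.Injective f → LinearMap.det f ≠ 0 := fun f hf =>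
      ((LinearEquiv.ofInjectiveEndo f hf).isUnit_det').ne_zero
    have hx0 := hne x' fun a b hab => Subtype.ext (hx (congrArg Subtype.val hab))
    have hz0 := hne z' fun a b hab => Subtype.ext (hz (congrArg Subtype.val hab))
    have hμ : μ ^ finrank E W = 1 := by
      rw [mul_comm (LinearMap.det z')] at hdet
      exact (mul_eq_right₀ (mul_ne_zero hx0 hz0)).1 hdet
    intro v hv
    -- A nonzero `v` forces `0 < dim W ≤ n`, so `dim W` divides `n!`.
    rcases eq_or_ne v 0 with rfl | hv0
    · exact zero_mem _
    have hpos : 0 < finrank E W := finrank_pos_iff_exists_ne_zero.2 ⟨⟨v, hv⟩, by simpa using hv0⟩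
    have hle : finrank E W ≤ n := (Submodule.finrank_le W).trans hn
    obtain ⟨t, ht⟩ := Nat.dvd_factorial hpos hle
    have hpow : ∀ m : ℕ, (c ^ m) v = μ ^ m • v := by
      intro m
      induction m with
      | zero => simp
      | succ m ih =>
        rw [pow_succ', Module.End.mul_apply, ih, map_smul, mem_eigenspace_iff.1 hv, smul_smul,
          pow_succ]
    rw [LinearMap.mem_ker, LinearMap.sub_apply, hpow, ht, pow_mul, hμ, one_pow, one_smul,
      Module.End.one_apply, sub_self]
  have htop : LinearMap.ker (c ^ n.factorial - 1) = ⊤ := top_le_iff.1 (hc ▸ iSup_le key)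
  exact sub_eq_zero.1 (LinearMap.ker_eq_top.1 htop)

namespace NilpotentMatrix

theorem generalLinearGroup_map_injective {R S : Type*} [CommRing R] [CommRing S] {n : ℕ}
    {f : R →+* S} (hf : Function.Injective f) :
    Function.Injective (Matrix.GeneralLinearGroup.map (n := Fin n) f) := fun _ _ h =>
  Units.ext (Matrix.map_injective hf (congrArg Units.val h))

theorem isSemisimple_toLin'_of_mul_eq_mul_diagonal {E : Type*} [Field E] {n : ℕ}
    {A : Matrix (Fin n) (Fin n) E} {P : GL (Fin n) E} {d : Fin n → E}
    (h : A * (P : Matrix (Fin n) (Fin n) E) = P * Matrix.diagonal d) :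
    Module.End.IsSemisimple (Matrix.toLin' A) := by
  classical
  -- Taking the image of `d` removes repeated eigenvalues, so `q` is squarefree; it annihilates the
  -- columns of `P`, which span.
  let q : E[X] := ∏ a ∈ Finset.univ.image d, (X - C a)
  have hq : Squarefree q :=
    (separable_prod_X_sub_C_iff' (f := id) |>.2 fun x _ y _ hxy => hxy).squarefree
  refine Module.End.isSemisimple_of_squarefree_aeval_eq_zero hq ?_
  set f : Module.End E (Fin n → E) := Matrix.toLin' A
  have hcol : ∀ j, (aeval f q) ((P : Matrix (Fin n) (Fin n) E).col j) = 0 := by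
    intro j
    have hj : f ((P : Matrix (Fin n) (Fin n) E).col j) =
        d j • (P : Matrix (Fin n) (Fin n) E).col j := by
      ext i
      have := congrFun (congrFun h i) j
      rw [Matrix.mul_diagonal, Matrix.mul_apply] at this
      simpa [f, Matrix.mulVec, dotProduct, mul_comm] using this
    by_cases h0 : (P : Matrix (Fin n) (Fin n) E).col j = 0
    · rw [h0, map_zero]
    · rw [Module.End.aeval_apply_of_hasEigenvector ⟨Module.End.mem_eigenspace_iff.2 hj, h0⟩]
      have : q.eval (d j) = 0 := by
        rw [eval_prod]
        exact Finset.prod_eq_zero (Finset.mem_image_of_mem d (Finset.mem_univ j)) (by simp)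
      rw [this, zero_smul]
  have hP : aeval f q ∘ₗ Matrix.toLin' (P : Matrix (Fin n) (Fin n) E) = 0 := by
    refine LinearMap.pi_ext' fun j => LinearMap.ext_ring ?_
    simpa using hcol j
  refine LinearMap.ext fun v => ?_
  have := LinearMap.congr_fun hP
    (((P⁻¹ : GL (Fin n) E) : Matrix (Fin n) (Fin n) E).mulVec v)
  simpa [← Matrix.coe_units_inv] using this

/-- The commutator is the product of `z x z⁻¹` and `x⁻¹`, both diagonalizable; they commute because
the commutator commutes with `x`. So it is semisimple and the eigenspace argument applies. -/
theorem commutatorElement_pow_factorial_eq_one {K : Type*} [Field K] {n : ℕ}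
    {z x : GL (Fin n) K} (hx : IsDiagonalizable x) (hcx : Commute ⁅z, x⁆ x)
    (hcz : Commute ⁅z, x⁆ z) : ⁅z, x⁆ ^ n.factorial = 1 := by
  obtain ⟨E₀, _, _, P₀, d, hP₀⟩ := hx
  -- Over an algebraically closed field the eigenspaces of a semisimple endomorphism span.
  let E := AlgebraicClosure E₀
  let ι : K →+* E := (algebraMap E₀ E).comp (algebraMap K E₀)
  let Φ : GL (Fin n) K →* GL (Fin n) E := Matrix.GeneralLinearGroup.map ι
  have hΦ : Function.Injective Φ :=
    generalLinearGroup_map_injective ι.injective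
  let P : GL (Fin n) E := Matrix.GeneralLinearGroup.map (algebraMap E₀ E) P₀
  let δ : Fin n → E := fun i => algebraMap E₀ E (d i)
  have hP : (Φ x : Matrix (Fin n) (Fin n) E) * P = P * Matrix.diagonal δ := by
    have h := congrArg (fun M => M.map (algebraMap E₀ E)) hP₀
    simp only [Matrix.map_mul] at h
    rw [Matrix.diagonal_map (map_zero _)] at h
    exact h
  have hδ : Matrix.diagonal δ * Matrix.diagonal (fun i => (δ i)⁻¹) = 1 := by
    have hu : IsUnit (Matrix.diagonal δ) := by
      have : Matrix.diagonal δ = ((P⁻¹ * (Φ x * P) : GL (Fin n) E) : Matrix _ _ E) := by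
        rw [Units.val_mul, Units.val_mul, hP, ← mul_assoc, P.inv_mul, one_mul]
      exact this ▸ Units.isUnit _
    have hne : ∀ i, δ i ≠ 0 := fun i =>
      (Pi.isUnit_iff.1 (Matrix.isUnit_diagonal.1 hu) i).ne_zero
    rw [Matrix.diagonal_mul_diagonal, ← Matrix.diagonal_one]
    congr 1
    ext i
    simp [hne i]
  have hPinv : ((Φ x)⁻¹ : GL (Fin n) E).val * P = P * Matrix.diagonal fun i => (δ i)⁻¹ := by
    calc ((Φ x)⁻¹ : GL (Fin n) E).val * P
        = (Φ x)⁻¹.val * (P * (Matrix.diagonal δ * Matrix.diagonal fun i => (δ i)⁻¹)) := by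
          rw [hδ, mul_one]
      _ = ((Φ x)⁻¹.val * (Φ x).val) * P * Matrix.diagonal fun i => (δ i)⁻¹ := by
          rw [← mul_assoc P.val, ← hP]; simp only [mul_assoc]
      _ = _ := by rw [Units.inv_mul, one_mul]
  let τ := Matrix.toLinAlgEquiv' (R := E) (n := Fin n)
  have hs₁ : Module.End.IsSemisimple (τ (Φ (z * x * z⁻¹)).val) := by
    refine isSemisimple_toLin'_of_mul_eq_mul_diagonal (P := Φ z * P) (d := δ) ?_
    rw [← Units.val_mul]
    have : Φ (z * x * z⁻¹) * (Φ z * P) = Φ z * (Φ x * P) := by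
      simp only [map_mul, map_inv]; group
    rw [this, Units.val_mul, Units.val_mul, hP, Units.val_mul, mul_assoc]
  have hs₂ : Module.End.IsSemisimple (τ (Φ x)⁻¹.val) :=
    isSemisimple_toLin'_of_mul_eq_mul_diagonal hPinv
  have hc : ⁅z, x⁆ = (z * x * z⁻¹) * x⁻¹ := commutatorElement_def z x
  have hcomm : Commute (z * x * z⁻¹) x⁻¹ := by
    have : z * x * z⁻¹ = ⁅z, x⁆ * x := by rw [hc]; group
    rw [this]
    exact (hcx.mul_left (Commute.refl x)).inv_right
  have hval : ∀ {a b : GL (Fin n) K}, Commute a b → Commute (τ (Φ a).val) (τ (Φ b).val) :=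
    fun h => ((h.map Φ).map (Units.coeHom _)).map τ
  have hs : Module.End.IsSemisimple (τ (Φ ⁅z, x⁆).val) := by
    have h1 : τ (Φ ⁅z, x⁆).val = τ (Φ (z * x * z⁻¹)).val * τ (Φ x)⁻¹.val := by
      rw [hc, map_mul, map_inv, Units.val_mul, map_mul]
    rw [h1]
    have h2 := hval hcomm
    rw [map_inv] at h2
    exact hs₁.mul_of_commute h2 hs₂
  have hinj : ∀ a : GL (Fin n) E, Function.Injective (τ a.val) := fun a => by
    have h1 : τ a⁻¹.val * τ a.val = 1 := by rw [← map_mul, Units.inv_mul, map_one]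
    exact Function.LeftInverse.injective (g := τ a⁻¹.val) fun v => LinearMap.congr_fun h1 v
  have hmain : τ (Φ ⁅z, x⁆).val ^ n.factorial = 1 := by
    refine Module.End.pow_factorial_eq_one_of_mul_mul_eq (x := τ (Φ x).val) (z := τ (Φ z).val)
      ?_ (hval hcx) (hval hcz) (hinj _) (hinj _) hs.iSup_eigenspace_eq_top (by simp)
    rw [← map_mul, ← map_mul, ← map_mul, ← Units.val_mul, ← Units.val_mul, ← Units.val_mul,
      ← map_mul, ← map_mul, ← map_mul]
    congr 3
    rw [hc]; group
  apply hΦ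
  apply Units.ext
  apply τ.injective
  rw [map_pow, Units.val_pow_eq_pow_val, map_pow, hmain, map_one, Units.val_one, map_one]

open Subgroup in
/-- In a nilpotent linear group of degree `n` generated by diagonalizable matrices, `n!`-th powers
of elements of the second centre are central. -/
theorem pow_factorial_mem_center {K : Type*} [Field K] {n : ℕ} {S : Set (GL (Fin n) K)}
    (hS : ∀ s ∈ S, IsDiagonalizable s) (z : closure S)
    (hz : z ∈ Subgroup.upperCentralSeries (closure S) 2) :
    z ^ n.factorial ∈ center (closure S) := by
  have hgen : S ⊆ centralizer {(z ^ n.factorial : GL (Fin n) K)} := by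
    intro x hxS
    let x' : closure S := ⟨x, subset_closure hxS⟩
    have hc : ⁅z, x'⁆ ∈ center (closure S) := by
      rw [← Subgroup.upperCentralSeries_one]
      exact Subgroup.mem_upperCentralSeries_succ_iff.1 hz x'
    have hcomm : ∀ y, Commute ⁅z, x'⁆ y := fun y => (mem_center_iff.1 hc y).symm
    have h1 := commutatorElement_pow_factorial_eq_one (hS x hxS)
      (congrArg Subtype.val (hcomm x')) (congrArg Subtype.val (hcomm z))
    have h2 : ⁅z ^ n.factorial, x'⁆ = 1 := by
      rw [commutatorElement_pow_left_of_mem_center hc]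
      exact Subtype.ext h1
    have h3 := congrArg Subtype.val (commutatorElement_eq_one_iff_mul_comm.1 h2)
    exact mem_centralizer_singleton_iff.2 h3.symm
  have hle := (closure_le _).2 hgen
  rw [mem_center_iff]
  intro y
  exact Subtype.ext (mem_centralizer_singleton_iff.1 (hle y.2))

/-! ### Unipotent parts in positive characteristic -/

theorem IsUnipotent.exists_pow_eq_one {R : Type*} [CommRing R] {n q : ℕ} [Fact q.Prime]
    [CharP R q] {a : GL (Fin n) R} (ha : IsUnipotent a) : ∃ b, a ^ q ^ b = 1 := by
  obtain ⟨m, hm⟩ := ha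
  have hq : 1 < q := (Fact.out : q.Prime).one_lt
  refine ⟨m, Units.ext ?_⟩
  have h1 : ((a : Matrix (Fin n) (Fin n) R) - 1) ^ q ^ m = 0 :=
    pow_eq_zero_of_le (Nat.lt_pow_self hq).le hm
  -- For `n = 0` the matrix ring is trivial and does not have characteristic `q`. Otherwise `(a - 1)
  -- ^ q ^ m = a ^ q ^ m - 1`.
  rcases n.eq_zero_or_pos with rfl | hn
  · exact Subsingleton.elim _ _
  have : Nonempty (Fin n) := ⟨⟨0, hn⟩⟩
  rw [sub_pow_char_pow_of_commute _ _ (Commute.one_right _), one_pow, sub_eq_zero] at h1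
  rw [Units.val_pow_eq_pow_val, h1, Units.val_one]

/-- In characteristic `q`, a diagonalizable matrix of finite order has order prime to `q`. -/
theorem IsDiagonalizable.pow_eq_one_of_pow_mul {K : Type*} [Field K] {n q : ℕ} [Fact q.Prime]
    [CharP K q] {s : GL (Fin n) K} (hs : IsDiagonalizable s) {a m : ℕ}
    (h : s ^ (m * q ^ a) = 1) : s ^ m = 1 := by
  obtain ⟨E, _, _, P, d, hP⟩ := hs
  let A : Matrix (Fin n) (Fin n) E :=
    (s : Matrix (Fin n) (Fin n) K).map (algebraMap K E)
  have : CharP E q := charP_of_injective_algebraMap (algebraMap K E).injective q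
  have hpow : ∀ k : ℕ, A ^ k * (P : Matrix (Fin n) (Fin n) E) =
      P * Matrix.diagonal (fun i => d i ^ k) := by
    intro k
    have h1 : SemiconjBy (P : Matrix (Fin n) (Fin n) E) (Matrix.diagonal d) A := hP.symm
    have h2 := (h1.pow_right k).eq
    rw [Matrix.diagonal_pow] at h2
    exact h2.symm
  have hA : ∀ k : ℕ, A ^ k = (s ^ k : GL (Fin n) K).val.map (algebraMap K E) := fun k => by
    rw [Units.val_pow_eq_pow_val]
    exact (map_pow (algebraMap K E).mapMatrix _ k).symm
  have hd : ∀ i, d i ^ (m * q ^ a) = 1 := by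
    have h1 := hpow (m * q ^ a)
    rw [hA, h, Units.val_one, Matrix.map_one _ (map_zero _) (map_one _), one_mul] at h1
    have h2 : Matrix.diagonal (fun i => d i ^ (m * q ^ a)) = 1 :=
      (P.isUnit.mul_eq_left.1 h1.symm)
    intro i
    simpa using congrFun (congrFun h2 i) i
  have hd' : ∀ i, d i ^ m = 1 := by
    intro i
    have h1 := hd i
    rw [pow_mul] at h1
    exact iterateFrobenius_inj E q a (by simpa [iterateFrobenius_def] using h1)
  have h2 := hpow m
  simp only [hd', Matrix.diagonal_one, mul_one] at h2
  have h3 : A ^ m = 1 := P.isUnit.mul_eq_right.1 h2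
  rw [hA] at h3
  apply Units.ext
  apply Matrix.map_injective (algebraMap K E).injective
  exact h3.trans (Matrix.map_one _ (map_zero _) (map_one _)).symm

/-- Over a finite field the unipotent part of `g` is a power of `g`, of `p`-power order. -/
theorem unipotentPart_mem_zpowers {K : Type*} [Field K] [Finite K] {n p : ℕ} [Fact p.Prime]
    [CharP K p] (g : GL (Fin n) K) :
    unipotentPart g ∈ Subgroup.zpowers g ∧ ∃ b, unipotentPart g ^ p ^ b = 1 := by
  obtain ⟨hs, hu, h1, h2⟩ := isJordanDecomposition_parts g
  set s := diagPart g
  set u := unipotentPart g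
  obtain ⟨b, hb⟩ := hu.exists_pow_eq_one (q := p)
  obtain ⟨a, m, hm, hN⟩ := Nat.exists_eq_pow_mul_and_not_dvd (orderOf_pos s).ne' p
    (Fact.out : p.Prime).ne_one
  have hsm : s ^ m = 1 := hs.pow_eq_one_of_pow_mul (a := a) (q := p) (by
    rw [mul_comm, ← hN, pow_orderOf_eq_one])
  have hco : m.Coprime (p ^ b) :=
    (((Fact.out : p.Prime).coprime_iff_not_dvd.2 hm).symm).pow_right b
  -- As `m` is prime to the order of `u`, `u` is a power of `u ^ m = g ^ m`.
  have hgm : g ^ m = u ^ m := by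
    have hc : Commute s u := h1.symm.trans h2
    rw [h1, hc.mul_pow, hsm, one_mul]
  refine ⟨?_, b, hb⟩
  have := mem_zpowers_pow_of_coprime hb hco
  rw [← hgm] at this
  exact Subgroup.zpowers_le.2 (Subgroup.npow_mem_zpowers g m) this

/-- The unipotent parts lie in the group generated by the `g i`, so its nilpotency can be used after
pulling them back to it. -/
theorem exists_pow_eq_one_of_mem_unipotentGroup {K : Type*} [Field K] [Finite K] {n r p : ℕ}
    [Fact p.Prime] [CharP K p] (g : Fin r → GL (Fin n) K)
    (hg : Group.IsNilpotent (Subgroup.closure (Set.range g))) {y : GL (Fin n) K}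
    (hy : y ∈ unipotentGroup g) : ∃ b, y ^ p ^ b = 1 := by
  let N := Subgroup.closure (Set.range g)
  let S := Set.range fun i => unipotentPart (g i)
  have hS : ∀ s ∈ S, s ∈ N ∧ ∃ b, s ^ p ^ b = 1 := by
    rintro _ ⟨i, rfl⟩
    obtain ⟨h1, h2⟩ := unipotentPart_mem_zpowers (p := p) (g i)
    exact ⟨Subgroup.zpowers_le.2 (Subgroup.subset_closure (Set.mem_range_self i)) h1, h2⟩
  have hle : Subgroup.closure S ≤ (Subgroup.closure (N.subtype ⁻¹' S)).map N.subtype :=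
    (Subgroup.closure_le _).2 fun s hs =>
      ⟨⟨s, (hS s hs).1⟩, Subgroup.subset_closure hs, rfl⟩
  obtain ⟨y', hy', rfl⟩ := hle hy
  obtain ⟨b, hb⟩ := Subgroup.exists_pow_prime_pow_eq_one_of_mem_closure (p := p)
    (S := N.subtype ⁻¹' S) (fun s hs => by
      obtain ⟨b, hb⟩ := (hS _ hs).2
      exact ⟨b, Subtype.ext hb⟩) hy'
  exact ⟨b, congrArg Subtype.val hb⟩

end NilpotentMatrix

/-! ### Reduction modulo `ϱ` and centrality -/

theorem mainTheorem11 {F : Type*} [Field F] [PerfectField F] {n r : ℕ}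
    (g : Fin r → GL (Fin n) F)
    (Δ : Subring F) (ϱ : Ideal Δ) [ϱ.IsMaximal] [Finite (Δ ⧸ ϱ)]
    (hϱ : NilpotentMatrix.IsAdmissibleIdeal n ϱ)
    (σ : Fin r → GL (Fin n) Δ)
    (hσ : ∀ i, Matrix.GeneralLinearGroup.map Δ.subtype (σ i) = NilpotentMatrix.diagPart (g i))
    (hnil : Group.IsNilpotent (NilpotentMatrix.diagGroup g))
    (p : ℕ) [CharP (Δ ⧸ ϱ) p] (hp : n < p)
    (h : GL (Fin n) Δ)
    (hmem : Matrix.GeneralLinearGroup.map Δ.subtype h ∈ NilpotentMatrix.diagGroup g)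
    (hu : NilpotentMatrix.congruenceHom n ϱ h ∈ NilpotentMatrix.congruenceUnipotentGroup ϱ σ) :
    (⟨Matrix.GeneralLinearGroup.map Δ.subtype h, hmem⟩ : NilpotentMatrix.diagGroup g) ∈
      Subgroup.center (NilpotentMatrix.diagGroup g) := by
  have hpp : p.Prime := (CharP.char_is_prime_or_zero (Δ ⧸ ϱ) p).resolve_right
    (CharP.char_ne_zero_of_finite (Δ ⧸ ϱ) p)
  have : Fact p.Prime := ⟨hpp⟩
  have hcop : n.factorial.Coprime p :=
    ((hpp.coprime_iff_not_dvd).2 fun hd => hp.not_ge (hpp.dvd_factorial.1 hd)).symm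
  let ι : GL (Fin n) Δ →* GL (Fin n) F := Matrix.GeneralLinearGroup.map Δ.subtype
  have hι : Function.Injective ι :=
    NilpotentMatrix.generalLinearGroup_map_injective Subtype.val_injective
  let ψ := NilpotentMatrix.congruenceHom n ϱ
  let h' : NilpotentMatrix.diagGroup g := ⟨ι h, hmem⟩
  have hσG : ∀ i, ι (σ i) ∈ NilpotentMatrix.diagGroup g := fun i => by
    rw [show ι (σ i) = _ from hσ i]
    exact Subgroup.subset_closure (Set.mem_range_self i)
  let σ' : Fin r → NilpotentMatrix.diagGroup g := fun i => ⟨ι (σ i), hσG i⟩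
  have hnilψ : Group.IsNilpotent (Subgroup.closure (Set.range fun i => ψ (σ i))) := by
    let H := Subgroup.closure (Set.range σ)
    have hHG : H.map ι = NilpotentMatrix.diagGroup g := by
      rw [MonoidHom.map_closure, ← Set.range_comp]
      exact congrArg Subgroup.closure (congrArg Set.range (funext hσ))
    have hH : Group.IsNilpotent H := by
      rw [Group.isNilpotent_congr (H.equivMapOfInjective ι hι), hHG]
      exact hnil
    have hψ : H.map ψ = Subgroup.closure (Set.range fun i => ψ (σ i)) := by
      rw [MonoidHom.map_closure, ← Set.range_comp]
      rfl
    rw [← hψ]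
    exact Group.nilpotent_of_surjective (ψ.subgroupMap H) (ψ.subgroupMap_surjective H)
  obtain ⟨b, hb⟩ : ∃ b, ψ h ^ p ^ b = 1 := by
    let : Field (Δ ⧸ ϱ) := Ideal.Quotient.field ϱ
    exact NilpotentMatrix.exists_pow_eq_one_of_mem_unipotentGroup (K := Δ ⧸ ϱ) _ hnilψ hu
  obtain ⟨k, hk⟩ := @Subgroup.exists_pow_mem_center (NilpotentMatrix.diagGroup g) _ hnil _
    (NilpotentMatrix.pow_factorial_mem_center (by
      rintro _ ⟨i, rfl⟩
      exact (NilpotentMatrix.isJordanDecomposition_parts (g i)).1))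
  obtain ⟨j, hj⟩ := @Subgroup.exists_commutatorElement_pow_eq_one _ _ hnil _ hk
  have hcomm : ∀ i, Commute h (σ i) := by
    intro i
    have hfin : ⁅h, σ i⁆ ^ (n.factorial ^ k) ^ j = 1 := by
      apply hι
      rw [map_pow, map_commutatorElement, map_one]
      exact congrArg Subtype.val (hj h' (σ' i))
    have hpow : Commute (h ^ n.factorial ^ k) (σ i) := by
      apply hι
      simpa using congrArg Subtype.val (Subgroup.mem_center_iff.1 (hk h') (σ' i)).symm
    -- `ψ h` has `p`-power order, so it is a power of its own `(n!) ^ k`-th power, which commutes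
    -- with `ψ (σ i)`.
    have hψc : Commute (ψ h) (ψ (σ i)) := by
      refine Commute.of_pow_left_of_coprime (a := n.factorial ^ k) ?_ hb
        ((hcop.pow_left k).pow_right b)
      rw [← map_pow]
      exact hpow.map ψ
    have hker : ⁅h, σ i⁆ ∈ ψ.ker := by
      rw [MonoidHom.mem_ker, map_commutatorElement, commutatorElement_eq_one_iff_commute]
      exact hψc
    have hpos : 0 < (n.factorial ^ k) ^ j := pow_pos (pow_pos n.factorial_pos k) j
    obtain ⟨h0, hq⟩ := hϱ _ hker (isOfFinOrder_iff_pow_eq_one.2 ⟨_, hpos, hfin⟩)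
    rw [← commutatorElement_eq_one_iff_commute]
    rcases (ringChar Δ).eq_zero_or_pos with hz | hqpos
    · exact h0 hz
    · have hchar := ringChar.charP Δ
      -- A positive characteristic of the domain `Δ` is a prime that vanishes in the quotient `Δ ⧸
      -- ϱ`, so it equals `p`.
      have hqp : ringChar Δ = p := by
        have hqprime := (CharP.char_is_prime_or_zero Δ (ringChar Δ)).resolve_right hqpos.ne'
        refine ((Nat.prime_dvd_prime_iff_eq hpp hqprime).1 ?_).symm
        rw [← CharP.cast_eq_zero_iff (Δ ⧸ ϱ) p, ← map_natCast (Ideal.Quotient.mk ϱ),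
          CharP.cast_eq_zero, map_zero]
      have : CharP Δ p := hqp ▸ hchar
      obtain ⟨e, he⟩ := (hq hqpos).exists_pow_eq_one (q := p)
      exact eq_one_of_pow_eq_one_of_coprime hfin he
        (((hcop.pow_left k).pow_left j).pow_right e)
  have hle : NilpotentMatrix.diagGroup g ≤ Subgroup.centralizer {ι h} := by
    refine (Subgroup.closure_le _).2 ?_
    rintro _ ⟨i, rfl⟩
    refine Subgroup.mem_centralizer_singleton_iff.2 ?_
    simp only [← hσ i]
    exact ((hcomm i).map ι).symm.eq
  rw [Subgroup.mem_center_iff]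
  intro y
  exact Subtype.ext (Subgroup.mem_centralizer_singleton_iff.1 (hle y.2))
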